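/- Let $(X,d)$ be a compact metric space and $\phi:X\to X$ continuous. For $m\ge 1$ put $d_m(x,y)=\max_{0\le k<m}d(\phi^k(x),\phi^k(y))$; for $\varepsilon>0$ let $\mathrm{sep}(m,\phi,\varepsilon)$ be the maximal cardinality of a set $A\subseteq X$ with $d_m(x,y)>\varepsilon$ for all distinct $x,y\in A$, and $\mathrm{sep}(\phi,\varepsilon)=\limsup_{m\to\infty}\frac1m\log \mathrm{sep}(m,\phi,\varepsilon)$. The lower and upper metric mean dimensions $\underline{\mathrm{mdim}}_M(X,d,\phi)$ and $\overline{\mathrm{mdim}}_M(X,d,\phi)$ are the $\liminf$ and $\limsup$ of $\mathrm{sep}(\phi,\varepsilon)/|\log\varepsilon|$ as $\varepsilon\to0^+$. For $\alpha\in[0,1]$, let $H^\alpha(X)$ be the set of continuous maps $\phi:X\to X$ for which there is a $K>0$ with $d(\phi(x),\phi(y))\le K\,d(x,y)^\alpha$ for all $x\ne y$ (so $H^0(X)$ consists of all continuous maps). On $[0,1]^n$ consider the sum metric $d^n(x,y)=\sum_{i=1}^n|x_i-y_i|$. For $0\le a<1$ define $\phi_a:[0,1]\to[0,1]$ as follows: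 $\phi_0$ is the identity; if $0<a<1$, let $r>0$ be such that $a=\frac1{r+1}$, let $C=\frac{3^r-1}{3^r}$, $a_k=\sum_{i=0}^{k-1}C\,3^{-ir}$ and $I_k=[a_{k-1},a_k]$ for $k\ge1$ (with $a_0=0$), let $T_k:I_k\to[0,1]$ be the increasing affine bijection and $g(x)=|1-|3x-1||$; then $\phi_a|_{I_k}=T_k^{-1}\circ g^k\circ T_k$ for every $k\ge1$, and $\phi_a(1)=1$. **Corollary.** Let $n\ge1$ be an integer, let $b\in[0,n]$ and put $\alpha=1-\frac bn$. There exists $\psi_b\in H^\alpha([0,1]^n)$ such that $$\underline{\mathrm{mdim}}_M([0,1]^n,d^n,\psi_b)=\overline{\mathrm{mdim}}_M([0,1]^n,d^n,\psi_b)=b .$$ Moreover, $\psi_b$ can be taken to be an $n$-fold product $\phi\times\cdots\times\phi$ of a map $\phi\in H^\alpha([0,1])$ with $\underline{\mathrm{mdim}}_M([0,1],|\cdot|,\phi)=\overline{\mathrm{mdim}}_M([0,1],|\cdot|,\phi)=\frac bn$, and, if $b<n$, with $\phi=\phi_{b/n}$. -/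

import Mathlib

open Filter Topology Set
open scoped unitInterval NNReal ENNReal

noncomputable section

namespace MetricMeanDim

/-- The Bowen metric `d_m(x, y) = max {d(φ^k x, φ^k y) : 0 ≤ k < m}` (for `m ≥ 1`). -/
def bowenDist {X : Type*} [MetricSpace X] (φ : X → X) (m : ℕ) (x y : X) : ℝ :=
  ⨆ k : Fin m, dist (φ^[(k : ℕ)] x) (φ^[(k : ℕ)] y)

/-- `A` is `(m, φ, ε)`-separated: `d_m(x, y) > ε` for any two distinct points of `A`. -/
def IsSeparatedSet {X : Type*} [MetricSpace X] (φ : X → X) (m : ℕ) (ε : ℝ) (A : Set X) : Prop :=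
  A.Pairwise fun x y => ε < bowenDist φ m x y

/-- `sep(m, φ, ε)`: the maximal cardinality of an `(m, φ, ε)`-separated set (as a supremum
in `ℕ∞` over finite separated sets). -/
def sepCard {X : Type*} [MetricSpace X] (φ : X → X) (m : ℕ) (ε : ℝ) : ℕ∞ :=
  ⨆ (A : Finset X) (_ : IsSeparatedSet φ m ε (A : Set X)), (A.card : ℕ∞)

/-- `sep(φ, ε) = limsup_{m → ∞} (1/m) log sep(m, φ, ε)`, an extended real. -/
def sepRate {X : Type*} [MetricSpace X] (φ : X → X) (ε : ℝ) : EReal :=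
  limsup (fun m : ℕ => ENNReal.log ((sepCard φ m ε : ℕ∞) : ℝ≥0∞) / ((m : ℝ) : EReal)) atTop

/-- Lower metric mean dimension `liminf_{ε → 0⁺} sep(φ, ε) / |log ε|`. -/
def lowerMdim {X : Type*} [MetricSpace X] (φ : X → X) : EReal :=
  liminf (fun ε : ℝ => sepRate φ ε / ((|Real.log ε| : ℝ) : EReal)) (𝓝[>] (0 : ℝ))

/-- Upper metric mean dimension `limsup_{ε → 0⁺} sep(φ, ε) / |log ε|`. -/
def upperMdim {X : Type*} [MetricSpace X] (φ : X → X) : EReal :=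
  limsup (fun ε : ℝ => sepRate φ ε / ((|Real.log ε| : ℝ) : EReal)) (𝓝[>] (0 : ℝ))

/-- `α`-Hölder continuous self-maps: continuous maps with
`d(φ x, φ y) ≤ K d(x, y)^α` for some constant `K`. (For `α > 0` continuity is automatic;
for `α = 0` on a bounded space this is the space of all continuous maps.) -/
def IsHolderMap {X : Type*} [MetricSpace X] (α : ℝ≥0) (φ : X → X) : Prop :=
  Continuous φ ∧ ∃ K : ℝ≥0, HolderWith K α φ

/-- The cube `[0,1]^n` with the sum metric. -/
abbrev Cube (n : ℕ) : Type := PiLp 1 (fun _ : Fin n => I)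

/-- The metric of `Cube n` is `d^n(x, y) = ∑ i, |x i - y i|`. -/
theorem cube_dist (n : ℕ) (x y : Cube n) : dist x y = ∑ i, |(x i : ℝ) - (y i : ℝ)| := by
  rw [PiLp.dist_eq_sum (by norm_num)]
  simp [Subtype.dist_eq, Real.dist_eq]

/-- The `n`-fold product `φ × ⋯ × φ` on the cube. -/
def prodMap (n : ℕ) (φ : I → I) : Cube n → Cube n :=
  fun x => WithLp.toLp 1 fun i => φ (x i)

/-- The three-legged zigzag `g(x) = |1 - |3x - 1||`. -/
def zigzag (x : ℝ) : ℝ := |1 - abs (3 * x - 1)|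

/-- The partition points `a_k = ∑_{i < k} C / 3^{i r}`, with `C = (3^r - 1) / 3^r`. -/
def node (r : ℝ) (k : ℕ) : ℝ :=
  ∑ i ∈ Finset.range k, (((3 : ℝ) ^ r - 1) / (3 : ℝ) ^ r) / (3 : ℝ) ^ ((i : ℝ) * r)

/-- The increasing affine bijection `T_{k+1}` from `[a_k, a_{k+1}]` onto `[0, 1]`. -/
def chart (r : ℝ) (k : ℕ) (x : ℝ) : ℝ := (x - node r k) / (node r (k + 1) - node r k)

/-- The inverse of `chart r k`. -/
def chartInv (r : ℝ) (k : ℕ) (t : ℝ) : ℝ := node r k + (node r (k + 1) - node r k) * t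

/-- `φ` is the map `φ_a` of the unit interval. It is the identity for `a = 0`; for `0 < a < 1`,
with `r > 0` given by `a = 1 / (r + 1)`, it is `T_k⁻¹ ∘ g^k ∘ T_k` on `[a_{k-1}, a_k]` for every
`k ≥ 1` (the index is shifted by one below), and it fixes the remaining point `1`. -/
def IsHorseshoeMap (a : ℝ) (φ : I → I) : Prop :=
  (a = 0 → φ = id) ∧
  ∀ r : ℝ, 0 < r → a = 1 / (r + 1) →
    φ 1 = 1 ∧
    ∀ (k : ℕ) (x : I), (x : ℝ) ∈ Set.Icc (node r k) (node r (k + 1)) →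
      (φ x : ℝ) = chartInv r k (zigzag^[k + 1] (chart r k x))

end MetricMeanDim

end

open Filter Topology Set
open scoped unitInterval NNReal ENNReal

noncomputable section

namespace MetricMeanDim

/-! ### Exponential growth rates and limits in ε -/

section Rates

variable {X : Type*} [MetricSpace X] {φ : X → X}

/-! Write `a = b / n`. The upper bound holds for every `(1 - a)`-Hölder map
(`upperMdim_le_of_holder`). Cut the cube into cells of side `ε / n`; the image of a cell has
diameter `O(ε ^ (1 - a))`, so each coordinate of the next cell has `O(ε ^ (-a))` possible values. An
orbit is coded by its first cell and one such choice per step, so the entropy at scale `ε` is at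
most `n * a * |log ε| + O(1)`.

For the lower bound, the map preserves consecutive intervals of lengths `ℓ k` and acts on the `k`-th
as an affine copy of `zigzag^[k + 1]`. Its laps give `3 ^ (k * m)` points separated in time `m` at
any scale below `ℓ k / 3 ^ (k + 1)`, and the product map gets the `n`-th power of this. If `ℓ k`
decays like `3 ^ (-r * k)`, the quotient of `n * k * log 3` by the logarithm of the inverse scale
tends to `n / (r + 1)` (`le_lowerMdim_of_length`). Geometric lengths give the maps `φ_a` with `a = 1
/ (r + 1)`; balancing steepness against the remaining length makes them `(1 - a)`-Hölder
(`holderWith_cascadeMap_horseshoeLength`), so both bounds agree. For `a = 1` lengths of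
subexponential decay play the role of `r = 0`, and for `a = 0` the identity serves. -/

theorem log_natCast_eq {N : ℕ} (hN : 0 < N) :
    ENNReal.log (((N : ℕ∞) : ℝ≥0∞)) = ((Real.log N : ℝ) : EReal) := by
  rw [ENNReal.log_pos_real] <;> simp [hN.ne']

theorem sepRate_le {ε : ℝ} {A B : ℕ} (hA : 0 < A) (hB : 0 < B)
    (h : ∀ m, sepCard φ m ε ≤ ((A * B ^ m : ℕ) : ℕ∞)) :
    sepRate φ ε ≤ ((Real.log B : ℝ) : EReal) := by
  have hlim : Tendsto (fun m : ℕ => (((Real.log A / m + Real.log B : ℝ)) : EReal)) atTop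
      (𝓝 ((Real.log B : ℝ) : EReal)) := by
    refine (continuous_coe_real_ereal.tendsto _).comp ?_
    simpa using (tendsto_const_div_atTop_nhds_zero_nat (Real.log A)).add_const (Real.log B)
  rw [← hlim.limsup_eq]
  refine limsup_le_limsup ?_
  filter_upwards [eventually_gt_atTop 0] with m hm
  have hm' : (0 : ℝ) < m := by exact_mod_cast hm
  calc _ ≤ ENNReal.log ((((A * B ^ m : ℕ) : ℕ∞) : ℝ≥0∞)) / ((m : ℝ) : EReal) := by
        refine EReal.div_le_div_right_of_nonneg (by exact_mod_cast hm'.le) ?_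
        exact ENNReal.log_monotone (by exact_mod_cast h m)
    _ = _ := by
        rw [log_natCast_eq (by positivity), ← EReal.coe_div]
        congr 1
        push_cast
        rw [Real.log_mul (by positivity) (by positivity), Real.log_pow]
        field_simp

theorem le_sepRate {ε : ℝ} {B : ℕ} (hB : 0 < B)
    (h : ∀ m, ((B ^ m : ℕ) : ℕ∞) ≤ sepCard φ m ε) :
    ((Real.log B : ℝ) : EReal) ≤ sepRate φ ε := by
  rw [← (tendsto_const_nhds (x := ((Real.log B : ℝ) : EReal)) (f := (atTop : Filter ℕ))).limsup_eq]
  refine limsup_le_limsup ?_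
  filter_upwards [eventually_gt_atTop 0] with m hm
  have hm' : (0 : ℝ) < m := by exact_mod_cast hm
  calc ((Real.log B : ℝ) : EReal)
      = ENNReal.log ((((B ^ m : ℕ) : ℕ∞) : ℝ≥0∞)) / ((m : ℝ) : EReal) := by
        rw [log_natCast_eq (by positivity), ← EReal.coe_div]
        congr 1
        push_cast
        rw [Real.log_pow]
        field_simp
    _ ≤ _ := by
        refine EReal.div_le_div_right_of_nonneg (by exact_mod_cast hm'.le) ?_
        exact ENNReal.log_monotone (by exact_mod_cast h m)

theorem upperMdim_le {c d : ℝ}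
    (h : ∀ ε : ℝ, 0 < ε → ε < 1 → sepRate φ ε ≤ ((c * |Real.log ε| + d : ℝ) : EReal)) :
    upperMdim φ ≤ (c : EReal) := by
  have hlog : Tendsto (fun ε : ℝ => |Real.log ε|) (𝓝[>] 0) atTop :=
    tendsto_abs_atBot_atTop.comp Real.tendsto_log_nhdsGT_zero
  have hlim : Tendsto (fun ε : ℝ => ((c + d / |Real.log ε| : ℝ) : EReal)) (𝓝[>] 0)
      (𝓝 (c : EReal)) := by
    refine (continuous_coe_real_ereal.tendsto _).comp ?_
    simpa using (hlog.const_div_atTop d).const_add c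
  rw [← hlim.limsup_eq]
  refine limsup_le_limsup ?_
  filter_upwards [Ioo_mem_nhdsGT (zero_lt_one' ℝ)] with ε hε
  have hl : 0 < |Real.log ε| := abs_pos.2 (Real.log_neg hε.1 hε.2).ne
  refine (EReal.div_le_div_right_of_nonneg (by exact_mod_cast hl.le) (h ε hε.1 hε.2)).trans_eq ?_
  rw [← EReal.coe_div]
  congr 1
  field_simp

/-- When `δ (k + 1) ≤ ε < δ k`, the rate is at least `L k` while `|log ε| ≤ -log δ (k + 1)`; hence
the shifted index in the limit. -/
theorem le_lowerMdim {δ L : ℕ → ℝ} {a : ℝ} (hδ : ∀ k, 0 < δ k) (hδ0 : Tendsto δ atTop (𝓝 0))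
    (hL : ∀ k, 0 ≤ L k)
    (h : ∀ k ε, 0 < ε → ε < δ k → ((L k : ℝ) : EReal) ≤ sepRate φ ε)
    (hlim : Tendsto (fun k => L k / -Real.log (δ (k + 1))) atTop (𝓝 a)) :
    (a : EReal) ≤ lowerMdim φ := by
  refine le_of_forall_lt fun c hc => ?_
  obtain ⟨c', hcc', hc'⟩ := EReal.lt_iff_exists_real_btwn.1 hc
  refine hcc'.trans_le (le_liminf_of_le (by isBoundedDefault) ?_)
  obtain ⟨K, hK⟩ := eventually_atTop.1 (hlim.eventually_const_lt (EReal.coe_lt_coe_iff.1 hc'))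
  -- This pushes the first index `j` with `δ j ≤ ε` beyond `K`. Using the first such index avoids
  -- assuming `δ` monotone.
  have hsmall : ∀ᶠ ε in 𝓝[>] (0 : ℝ), ∀ i ∈ Finset.range (K + 1), ε < δ i :=
    (Finset.eventually_all _).2 fun i _ =>
      (eventually_lt_nhds (hδ i)).filter_mono nhdsWithin_le_nhds
  filter_upwards [hsmall, Ioo_mem_nhdsGT (zero_lt_one' ℝ)] with ε hε hε1
  have hex : ∃ j, δ j ≤ ε := ((hδ0.eventually_lt_const hε1.1).exists).imp fun _ => le_of_lt
  classical
  have hj := Nat.find_spec hex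
  have hmin : ∀ i, i < Nat.find hex → ε < δ i := fun i hi => not_le.1 (Nat.find_min hex hi)
  generalize Nat.find hex = j at hj hmin
  have hKj : K < j := by
    by_contra hcon
    exact absurd (hε j (by simp; omega)) (not_lt.2 hj)
  obtain ⟨k, rfl⟩ : ∃ k, j = k + 1 := ⟨j - 1, by omega⟩
  have hlneg := Real.log_neg hε1.1 hε1.2
  have hle : Real.log (δ (k + 1)) ≤ Real.log ε := Real.log_le_log (hδ _) hj
  calc ((c' : ℝ) : EReal) ≤ ((L k / |Real.log ε| : ℝ) : EReal) := by
        refine EReal.coe_le_coe_iff.2 ((hK k (by omega)).le.trans ?_)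
        rw [abs_of_neg hlneg]
        exact div_le_div_of_nonneg_left (hL k) (by linarith) (by linarith)
    _ ≤ _ := by
        rw [EReal.coe_div]
        exact EReal.div_le_div_right_of_nonneg (by exact_mod_cast abs_nonneg _)
          (h k ε hε1.1 (hmin k (by omega)))

/-- The cell `q x` and the symbol `s x` determine the next cell, so the first cell and `m` symbols
determine the itinerary; points sharing an itinerary stay `ε`-close and cannot be separated. -/
theorem sepCard_le_of_coding {S T : Type*} [Fintype S] [Fintype T] {ε : ℝ} (hε : 0 ≤ ε)
    (q : X → S) (s : X → T) (hstep : ∀ x y, q x = q y → s x = s y → q (φ x) = q (φ y))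
    (hq : ∀ x y, q x = q y → dist x y ≤ ε) (m : ℕ) :
    sepCard φ m ε ≤ ((Fintype.card S * Fintype.card T ^ m : ℕ) : ℕ∞) := by
  refine iSup₂_le fun A hA => ?_
  rw [Nat.cast_le]
  have hinj : Set.InjOn (fun x => (q x, fun k : Fin m => s (φ^[(k : ℕ)] x))) (A : Set X) := by
    intro x hx y hy hxy
    by_contra hne
    refine absurd (hA hx hy hne) (not_lt.2 ?_)
    obtain ⟨h0, h1⟩ := Prod.mk.inj hxy
    have hk : ∀ k, k ≤ m → q (φ^[k] x) = q (φ^[k] y) := by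
      intro k
      induction k with
      | zero => intro _; exact h0
      | succ k ih =>
        intro hkm
        rw [Function.iterate_succ_apply', Function.iterate_succ_apply']
        exact hstep _ _ (ih (by omega)) (congrFun h1 ⟨k, by omega⟩)
    exact Real.iSup_le (fun k => hq _ _ (hk k k.2.le)) hε
  calc A.card ≤ (Finset.univ : Finset (S × (Fin m → T))).card :=
        Finset.card_le_card_of_injOn _ (fun _ _ => Finset.mem_coe.2 (Finset.mem_univ _)) hinj
    _ = _ := by simp

theorem card_le_sepCard {m : ℕ} {ε : ℝ} {A : Finset X} (hA : IsSeparatedSet φ m ε (A : Set X)) :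
    (A.card : ℕ∞) ≤ sepCard φ m ε :=
  le_iSup₂_of_le A hA le_rfl

theorem dist_iterate_le_bowenDist {m k : ℕ} (hk : k < m) (x y : X) :
    dist (φ^[k] x) (φ^[k] y) ≤ bowenDist φ m x y :=
  le_ciSup (f := fun k : Fin m => dist (φ^[(k : ℕ)] x) (φ^[(k : ℕ)] y))
    (Set.finite_range _).bddAbove ⟨k, hk⟩

end Rates

/-! ### Upper bound for Hölder maps -/

section HolderBound

variable {X : Type*} [MetricSpace X] {φ : X → X}

theorem exists_representative {X S : Type*} (q : X → S) :
    ∃ ρ : X → X, (∀ x, q (ρ x) = q x) ∧ ∀ x y, q x = q y → ρ x = ρ y := by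
  refine ⟨fun x => Quotient.out (Quotient.mk (Setoid.ker q) x), fun x => ?_, fun x y h => ?_⟩
  · exact Quotient.mk_out (s := Setoid.ker q) x
  · have : Quotient.mk (Setoid.ker q) x = Quotient.mk (Setoid.ker q) y := Quotient.sound h
    simp only [this]

/-- Grid cells have side `ε / n`. The symbol of `x` is the displacement of the cell of `φ x` from
the cell of `φ (ρ x)`, where `ρ x` is a fixed representative of the cell of `x`. The coordinates `c`
cover both the interval and the cube. -/
theorem sepRate_le_of_coordinates {n : ℕ} (hn : 1 ≤ n) (c : X → Fin n → ℝ)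
    (hc : ∀ x i, c x i ∈ Set.Icc (0 : ℝ) 1) (hc₁ : ∀ x y i, |c x i - c y i| ≤ dist x y)
    (hc₂ : ∀ x y, dist x y ≤ ∑ i, |c x i - c y i|) {ε η : ℝ} (hε : 0 < ε)
    (hφ : ∀ x y, dist x y ≤ ε → dist (φ x) (φ y) ≤ η) :
    sepRate φ ε ≤ ((Real.log ((2 * (⌊n / ε * η⌋₊ + 1) + 1) ^ n : ℕ) : ℝ) : EReal) := by
  have hn' : (0 : ℝ) < n := by exact_mod_cast hn
  have hs : 0 < n / ε := div_pos hn' hε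
  -- An integer exceeding `η` measured in grid units, so the cell displacement is at most `L` in
  -- each coordinate.
  set L : ℕ := ⌊n / ε * η⌋₊ + 1 with hL
  set f : X → Fin n → ℤ := fun x i => ⌊n / ε * c x i⌋ with hf
  have hf_dist : ∀ x y, f x = f y → dist x y ≤ ε := by
    intro x y hxy
    have hi : ∀ i, |c x i - c y i| ≤ ε / n := by
      intro i
      have := Int.abs_sub_lt_one_of_floor_eq_floor (congrFun hxy i)
      rw [← mul_sub, abs_mul, abs_of_pos hs] at this
      rw [le_div_iff₀ hn']
      rw [div_mul_eq_mul_div, div_lt_one hε] at this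
      linarith
    calc dist x y ≤ ∑ i, |c x i - c y i| := hc₂ x y
      _ ≤ ∑ _i : Fin n, ε / n := Finset.sum_le_sum fun i _ => hi i
      _ = ε := by simp; field_simp
  have hf_mem : ∀ x i, f x i ∈ Finset.Icc (0 : ℤ) ⌊n / ε⌋ := by
    intro x i
    rw [Finset.mem_Icc]
    refine ⟨Int.floor_nonneg.2 (mul_nonneg hs.le (hc x i).1), Int.floor_le_floor ?_⟩
    exact mul_le_of_le_one_right hs.le (hc x i).2
  obtain ⟨ρ, hρ, hρ'⟩ := exists_representative f
  have hstep : ∀ x i, f (φ x) i - f (φ (ρ x)) i ∈ Finset.Icc (-(L : ℤ)) L := by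
    intro x i
    have hd : |n / ε * c (φ x) i - n / ε * c (φ (ρ x)) i| ≤ n / ε * η := by
      rw [← mul_sub, abs_mul, abs_of_pos hs]
      exact mul_le_mul_of_nonneg_left
        ((hc₁ _ _ i).trans (hφ _ _ (hf_dist _ _ (hρ x).symm))) hs.le
    have hlt : n / ε * η < L := by
      rw [hL]; push_cast; exact Nat.lt_floor_add_one _
    rw [abs_le] at hd
    rw [Finset.mem_Icc]
    have h1 := Int.floor_le (n / ε * c (φ x) i)
    have h2 := Int.lt_floor_add_one (n / ε * c (φ x) i)
    have h3 := Int.floor_le (n / ε * c (φ (ρ x)) i)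
    have h4 := Int.lt_floor_add_one (n / ε * c (φ (ρ x)) i)
    simp only [hf]
    constructor
    · have : (-(L : ℤ) : ℝ) < (⌊n / ε * c (φ x) i⌋ - ⌊n / ε * c (φ (ρ x)) i⌋ + 1 : ℤ) := by
        push_cast; linarith
      have := (Int.cast_lt (R := ℝ)).1 (by push_cast at this ⊢; exact this :
        ((-(L : ℤ) : ℤ) : ℝ) < ((⌊n / ε * c (φ x) i⌋ - ⌊n / ε * c (φ (ρ x)) i⌋ + 1 : ℤ) : ℝ))
      omega
    · have : ((⌊n / ε * c (φ x) i⌋ - ⌊n / ε * c (φ (ρ x)) i⌋ : ℤ) : ℝ) < ((L + 1 : ℤ) : ℝ) := by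
        push_cast; linarith
      have := (Int.cast_lt (R := ℝ)).1 this
      omega
  have key : ∀ m, sepCard φ m ε ≤ _ := sepCard_le_of_coding (φ := φ) hε.le
    (q := fun x => (fun i => ⟨f x i, hf_mem x i⟩ : Fin n → Finset.Icc (0 : ℤ) ⌊n / ε⌋))
    (s := fun x => (fun i => ⟨_, hstep x i⟩ : Fin n → Finset.Icc (-(L : ℤ)) L))
    (by
      intro x y hq hs'
      have hxy : f x = f y := by
        funext i; simpa using congrFun hq i
      have hr := hρ' x y hxy
      funext i
      have := congrFun hs' i
      simp only [Subtype.mk.injEq, hr] at this ⊢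
      linarith)
    (by
      intro x y hq
      refine hf_dist x y ?_
      funext i; simpa using congrFun hq i)
  have hcard : Fintype.card (Fin n → Finset.Icc (-(L : ℤ)) L) = (2 * L + 1) ^ n := by
    simp only [Fintype.card_pi, Fintype.card_coe, Int.card_Icc, Finset.prod_const, Finset.card_univ,
      Fintype.card_fin]
    congr 1
    omega
  refine sepRate_le (A := Fintype.card (Fin n → Finset.Icc (0 : ℤ) ⌊n / ε⌋)) ?_ (by positivity)
    (fun m => ?_)
  · have : (0 : ℤ) ≤ ⌊n / ε⌋ := Int.floor_nonneg.2 hs.le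
    have : Nonempty (Finset.Icc (0 : ℤ) ⌊n / ε⌋) := ⟨⟨0, by simpa using this⟩⟩
    exact Fintype.card_pos
  · rw [← hcard]
    exact key m

theorem upperMdim_le_of_holder {n : ℕ} (hn : 1 ≤ n) (c : X → Fin n → ℝ)
    (hc : ∀ x i, c x i ∈ Set.Icc (0 : ℝ) 1) (hc₁ : ∀ x y i, |c x i - c y i| ≤ dist x y)
    (hc₂ : ∀ x y, dist x y ≤ ∑ i, |c x i - c y i|) {K α : ℝ≥0} (hα : α ≤ 1)
    (hφ : HolderWith K α φ) :
    upperMdim φ ≤ ((n * (1 - α) : ℝ) : EReal) := by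
  have hn' : (0 : ℝ) < n := by exact_mod_cast hn
  -- As `ε ^ (α - 1) ≥ 1`, the count `2 * (n * K * ε ^ (α - 1) + 1) + 1` is at most `(2 * n * K + 3)
  -- * ε ^ (α - 1)`.
  refine upperMdim_le (d := n * Real.log (2 * n * K + 3)) fun ε hε hε1 => ?_
  refine (sepRate_le_of_coordinates (η := K * ε ^ (α : ℝ)) hn c hc hc₁ hc₂ hε fun x y h => ?_).trans ?_
  · refine (hφ.dist_le x y).trans ?_
    gcongr
  · rw [EReal.coe_le_coe_iff]
    push_cast
    rw [Real.log_pow, abs_of_neg (Real.log_neg hε hε1), mul_assoc, ← mul_add]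
    gcongr
    have hα' : (α : ℝ) ≤ 1 := by exact_mod_cast hα
    have hpow : n / ε * (K * ε ^ (α : ℝ)) = n * K * ε ^ ((α : ℝ) - 1) := by
      rw [Real.rpow_sub_one hε.ne']; ring
    have hone : 1 ≤ ε ^ ((α : ℝ) - 1) :=
      Real.one_le_rpow_of_pos_of_le_one_of_nonpos hε hε1.le (by linarith)
    have hfl : (⌊n / ε * (K * ε ^ (α : ℝ))⌋₊ : ℝ) ≤ n * K * ε ^ ((α : ℝ) - 1) := by
      rw [← hpow]; exact Nat.floor_le (by positivity)
    calc _ ≤ Real.log ((2 * n * K + 3) * ε ^ ((α : ℝ) - 1)) := by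
          refine Real.log_le_log (by positivity) ?_
          nlinarith
      _ = _ := by
          rw [Real.log_mul (by positivity) (by positivity), Real.log_rpow hε]
          ring

end HolderBound

/-! ### Laps and itineraries of the zigzag -/

section Zigzag

theorem zigzag_mem {x : ℝ} (hx : x ∈ Set.Icc (0 : ℝ) 1) : zigzag x ∈ Set.Icc (0 : ℝ) 1 := by
  obtain ⟨h0, h1⟩ := hx
  refine ⟨abs_nonneg _, ?_⟩
  have h2 : |3 * x - 1| ≤ 2 := abs_le.2 ⟨by linarith, by linarith⟩
  exact abs_le.2 ⟨by linarith, by linarith [abs_nonneg (3 * x - 1)]⟩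

theorem zigzag_iterate_mem (k : ℕ) {x : ℝ} (hx : x ∈ Set.Icc (0 : ℝ) 1) :
    zigzag^[k] x ∈ Set.Icc (0 : ℝ) 1 :=
  (show Set.MapsTo zigzag (Set.Icc 0 1) (Set.Icc 0 1) from fun _ h => zigzag_mem h).iterate k hx

theorem zigzag_iterate_zero (k : ℕ) : zigzag^[k] 0 = 0 :=
  Function.iterate_fixed (by simp [zigzag]) k

theorem zigzag_iterate_one (k : ℕ) : zigzag^[k] 1 = 1 :=
  Function.iterate_fixed (by norm_num [zigzag]) k

theorem abs_zigzag_sub_le (x y : ℝ) : |zigzag x - zigzag y| ≤ 3 * |x - y| := by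
  calc |zigzag x - zigzag y| ≤ |(1 - abs (3 * x - 1)) - (1 - abs (3 * y - 1))| :=
        abs_abs_sub_abs_le _ _
    _ = |abs (3 * x - 1) - abs (3 * y - 1)| := by rw [sub_sub_sub_cancel_left, abs_sub_comm]
    _ ≤ |(3 * x - 1) - (3 * y - 1)| := abs_abs_sub_abs_le _ _
    _ = 3 * |x - y| := by
      rw [show (3 * x - 1) - (3 * y - 1) = 3 * (x - y) by ring, abs_mul, abs_of_pos three_pos]

theorem abs_zigzag_iterate_sub_le (k : ℕ) (x y : ℝ) :
    |zigzag^[k] x - zigzag^[k] y| ≤ 3 ^ k * |x - y| := by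
  induction k with
  | zero => simp
  | succ k ih =>
    rw [Function.iterate_succ_apply', Function.iterate_succ_apply']
    refine (abs_zigzag_sub_le _ _).trans ?_
    rw [pow_succ]
    linarith

theorem continuous_zigzag_iterate (k : ℕ) : Continuous zigzag^[k] :=
  Continuous.iterate (by unfold zigzag; fun_prop) k

/-- On `[0, 1]`, the iterate `zigzag^[k]` is the triangle wave `dist(3 ^ k * x, 2ℤ)`. -/
theorem zigzag_iterate_eq (k : ℕ) {x t : ℝ} (hx : x ∈ Set.Icc (0 : ℝ) 1)
    (ht : t ∈ Set.Icc (0 : ℝ) 1) (j : ℤ) (h : 3 ^ k * x = 2 * j + t ∨ 3 ^ k * x = 2 * j - t) :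
    zigzag^[k] x = t := by
  induction k generalizing x j with
  | zero =>
    obtain ⟨hx0, hx1⟩ := hx
    obtain ⟨ht0, ht1⟩ := ht
    simp only [pow_zero, one_mul, Function.iterate_zero, id] at h ⊢
    have hj1 : (-1 : ℤ) < j := by
      have : ((-1 : ℤ) : ℝ) < j := by push_cast; rcases h with h | h <;> linarith
      exact_mod_cast this
    have hj2 : j < 2 := by
      have : (j : ℝ) < ((2 : ℤ) : ℝ) := by push_cast; rcases h with h | h <;> linarith
      exact_mod_cast this
    obtain rfl | rfl : j = 0 ∨ j = 1 := by omega
    all_goals push_cast at h; rcases h with h | h <;> linarith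
  | succ k ih =>
    rw [Function.iterate_succ_apply]
    have hmem := zigzag_mem hx
    obtain ⟨hx0, hx1⟩ := hx
    rw [pow_succ] at h
    rcases le_total (3 * x) 1 with h1 | h1
    · have hz : zigzag x = 3 * x := by
        rw [zigzag, abs_of_nonpos (by linarith : 3 * x - 1 ≤ 0), abs_of_nonneg (by linarith)]
        ring
      refine ih hmem j ?_
      rw [hz]
      rcases h with h | h
      · left; linarith
      · right; linarith
    · rcases le_total (3 * x) 2 with h2 | h2
      · have hz : zigzag x = 2 - 3 * x := by
          rw [zigzag, abs_of_nonneg (by linarith : 0 ≤ 3 * x - 1), abs_of_nonneg (by linarith)]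
          ring
        -- The middle lap reverses orientation: `3 ^ k * (2 - 3 * x)` is `2 * 3 ^ k` minus the old
        -- value, which swaps the two signs.
        refine ih hmem (3 ^ k - j) ?_
        rw [hz]
        push_cast
        rcases h with h | h
        · right; linarith
        · left; linarith
      · have hz : zigzag x = 3 * x - 2 := by
          rw [zigzag, abs_of_nonneg (by linarith : 0 ≤ 3 * x - 1), abs_of_nonpos (by linarith)]
          ring
        refine ih hmem (j - 3 ^ k) ?_
        rw [hz]
        push_cast
        rcases h with h | h
        · left; linarith
        · right; linarith

/-- The increasing laps of `zigzag^[j + 1]` start at `2 * i / 3 ^ (j + 1)`, and those with `i < 3 ^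
j` lie in `[0, 1]`. Each maps onto `[0, 1]`, so every word is realised by successive pullback; two
such laps have a decreasing lap, of width `3 ^ -(j + 1)`, between them. -/
theorem exists_zigzag_itineraries (j m : ℕ) :
    ∃ p : (Fin m → Fin (3 ^ j)) → ℝ, (∀ s, p s ∈ Set.Icc (0 : ℝ) 1) ∧
      ∀ s s', s ≠ s' → ∃ k < m, ((3 : ℝ) ^ (j + 1))⁻¹ ≤
        |(zigzag^[j + 1])^[k] (p s) - (zigzag^[j + 1])^[k] (p s')| := by
  have h3 : (0 : ℝ) < 3 ^ (j + 1) := by positivity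
  induction m with
  | zero => exact ⟨fun _ => 0, by simp, fun s s' h => (h (Subsingleton.elim _ _)).elim⟩
  | succ m ih =>
    obtain ⟨p, hp, hsep⟩ := ih
    have hmem : ∀ (i : Fin (3 ^ j)) (t : ℝ), t ∈ Set.Icc (0 : ℝ) 1 →
        (2 * (i : ℕ) + t) / 3 ^ (j + 1) ∈ Set.Icc (0 : ℝ) 1 := by
      intro i t ht
      refine ⟨div_nonneg (by linarith [ht.1, (Nat.cast_nonneg (i : ℕ) : (0 : ℝ) ≤ _)]) h3.le, ?_⟩
      rw [div_le_one h3, pow_succ]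
      have hi : (((i : ℕ) + 1 : ℕ) : ℝ) ≤ ((3 ^ j : ℕ) : ℝ) := Nat.cast_le.2 i.2
      push_cast at hi
      have h1 : (1 : ℝ) ≤ 3 ^ j := one_le_pow₀ (by norm_num)
      linarith [ht.2]
    have hmap : ∀ (i : Fin (3 ^ j)) (t : ℝ), t ∈ Set.Icc (0 : ℝ) 1 →
        zigzag^[j + 1] ((2 * (i : ℕ) + t) / 3 ^ (j + 1)) = t := by
      intro i t ht
      refine zigzag_iterate_eq _ (hmem i t ht) ht (i : ℕ) (Or.inl ?_)
      push_cast
      field_simp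
    refine ⟨fun s => (2 * (s 0 : ℕ) + p (Fin.tail s)) / 3 ^ (j + 1), fun s => hmem _ _ (hp _),
      fun s s' hss => ?_⟩
    by_cases h0 : s 0 = s' 0
    · have htail : Fin.tail s ≠ Fin.tail s' := fun h => hss <| by
        rw [← Fin.cons_self_tail s, ← Fin.cons_self_tail s', h, h0]
      obtain ⟨k, hk, hd⟩ := hsep _ _ htail
      refine ⟨k + 1, by omega, ?_⟩
      rwa [Function.iterate_succ_apply (zigzag^[j + 1]) k,
        Function.iterate_succ_apply (zigzag^[j + 1]) k, hmap _ _ (hp _), hmap _ _ (hp _)]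
    · refine ⟨0, by omega, ?_⟩
      simp only [Function.iterate_zero, id]
      rw [← sub_div, abs_div, abs_of_pos h3, inv_eq_one_div]
      refine div_le_div_of_nonneg_right ?_ h3.le
      have ha := hp (Fin.tail s)
      have hb := hp (Fin.tail s')
      have hne : ((s 0 : ℕ)) ≠ (s' 0 : ℕ) := fun h => h0 (Fin.ext h)
      rcases lt_or_gt_of_ne hne with hlt | hlt
      · have : (((s 0 : ℕ) + 1 : ℕ) : ℝ) ≤ ((s' 0 : ℕ) : ℝ) := Nat.cast_le.2 hlt
        push_cast at this
        rw [abs_sub_comm]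
        exact le_trans (by linarith [ha.2, hb.1]) (le_abs_self _)
      · have : (((s' 0 : ℕ) + 1 : ℕ) : ℝ) ≤ ((s 0 : ℕ) : ℝ) := Nat.cast_le.2 hlt
        push_cast at this
        exact le_trans (by linarith [ha.1, hb.2]) (le_abs_self _)

end Zigzag

/-! ### Zigzags on consecutive intervals -/

section Cascade

variable {ℓ : ℕ → ℝ}

/-- The coordinate of `x` on the `k`-th of the consecutive intervals of lengths `ℓ 0, ℓ 1, …`,
clamped to `[0, 1]`. -/
def clampedCoord (ℓ : ℕ → ℝ) (k : ℕ) (x : ℝ) : ℝ :=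
  max 0 (min 1 ((x - ∑ i ∈ Finset.range k, ℓ i) / ℓ k))

/-- The map acting on the `k`-th of the consecutive intervals of lengths `ℓ 0, ℓ 1, …` as an
affine copy of `zigzag^[k + 1]`. -/
def cascade (ℓ : ℕ → ℝ) (x : ℝ) : ℝ :=
  ∑' k, ℓ k * zigzag^[k + 1] (clampedCoord ℓ k x)

theorem clampedCoord_mem (k : ℕ) (x : ℝ) : clampedCoord ℓ k x ∈ Set.Icc (0 : ℝ) 1 :=
  ⟨le_max_left _ _, max_le zero_le_one (min_le_left _ _)⟩

theorem continuous_clampedCoord (k : ℕ) : Continuous (clampedCoord ℓ k) := by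
  unfold clampedCoord; fun_prop

theorem clampedCoord_eq_one (hℓ : ∀ k, 0 < ℓ k) {k : ℕ} {x : ℝ}
    (h : ∑ i ∈ Finset.range (k + 1), ℓ i ≤ x) : clampedCoord ℓ k x = 1 := by
  rw [Finset.sum_range_succ] at h
  have : 1 ≤ (x - ∑ i ∈ Finset.range k, ℓ i) / ℓ k := by
    rw [one_le_div (hℓ k)]; linarith
  rw [clampedCoord, min_eq_left this, max_eq_right zero_le_one]

theorem clampedCoord_eq_zero (hℓ : ∀ k, 0 < ℓ k) {k : ℕ} {x : ℝ}
    (h : x ≤ ∑ i ∈ Finset.range k, ℓ i) : clampedCoord ℓ k x = 0 := by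
  have : (x - ∑ i ∈ Finset.range k, ℓ i) / ℓ k ≤ 0 :=
    div_nonpos_of_nonpos_of_nonneg (by linarith) (hℓ k).le
  rw [clampedCoord, max_eq_left ((min_le_right _ _).trans this)]

theorem clampedCoord_affine (hℓ : ∀ k, 0 < ℓ k) (k : ℕ) {t : ℝ} (ht : t ∈ Set.Icc (0 : ℝ) 1) :
    clampedCoord ℓ k (∑ i ∈ Finset.range k, ℓ i + ℓ k * t) = t := by
  rw [clampedCoord, add_sub_cancel_left, mul_div_cancel_left₀ _ (hℓ k).ne', min_eq_right ht.2,
    max_eq_right ht.1]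

theorem abs_clampedCoord_sub_le (hℓ : ∀ k, 0 < ℓ k) (k : ℕ) (x y : ℝ) :
    ℓ k * |clampedCoord ℓ k x - clampedCoord ℓ k y| ≤ |x - y| := by
  have hmax : ∀ u v : ℝ, |max 0 (min 1 u) - max 0 (min 1 v)| ≤ |u - v| := fun u v => by
    have h1 := abs_max_sub_max_le_max 0 (min 1 u) 0 (min 1 v)
    have h2 := abs_min_sub_min_le_max 1 u 1 v
    rw [sub_self, abs_zero, max_eq_right (abs_nonneg (min 1 u - min 1 v))] at h1
    rw [sub_self, abs_zero, max_eq_right (abs_nonneg (u - v))] at h2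
    exact h1.trans h2
  have := hmax ((x - ∑ i ∈ Finset.range k, ℓ i) / ℓ k) ((y - ∑ i ∈ Finset.range k, ℓ i) / ℓ k)
  rw [← sub_div, sub_sub_sub_cancel_right, abs_div, abs_of_pos (hℓ k), le_div_iff₀ (hℓ k)] at this
  rw [mul_comm]
  exact this

theorem cascade_term_mem (hℓ : ∀ k, 0 < ℓ k) (k : ℕ) (x : ℝ) :
    ℓ k * zigzag^[k + 1] (clampedCoord ℓ k x) ∈ Set.Icc 0 (ℓ k) := by
  have h := zigzag_iterate_mem (k + 1) (clampedCoord_mem (ℓ := ℓ) k x)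
  exact ⟨mul_nonneg (hℓ k).le h.1, mul_le_of_le_one_right (hℓ k).le h.2⟩

theorem summable_cascade (hℓ : ∀ k, 0 < ℓ k) (hs : HasSum ℓ 1) (x : ℝ) :
    Summable fun k => ℓ k * zigzag^[k + 1] (clampedCoord ℓ k x) :=
  hs.summable.of_nonneg_of_le (fun k => (cascade_term_mem hℓ k x).1)
    fun k => (cascade_term_mem hℓ k x).2

theorem cascade_mem (hℓ : ∀ k, 0 < ℓ k) (hs : HasSum ℓ 1) (x : ℝ) :
    cascade ℓ x ∈ Set.Icc (0 : ℝ) 1 := by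
  refine ⟨tsum_nonneg fun k => (cascade_term_mem hℓ k x).1, ?_⟩
  rw [← hs.tsum_eq]
  exact (summable_cascade hℓ hs x).tsum_le_tsum (fun k => (cascade_term_mem hℓ k x).2) hs.summable

theorem continuous_cascade (hℓ : ∀ k, 0 < ℓ k) (hs : HasSum ℓ 1) : Continuous (cascade ℓ) := by
  refine continuous_tsum (fun k => ?_) hs.summable fun k x => ?_
  · exact ((continuous_zigzag_iterate _).comp (continuous_clampedCoord k)).const_mul _
  · rw [Real.norm_eq_abs, abs_of_nonneg (cascade_term_mem hℓ k x).1]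
    exact (cascade_term_mem hℓ k x).2

/-- The zigzag fixes `0` and `1`, so earlier terms contribute their full length and later ones
nothing. -/
theorem cascade_affine (hℓ : ∀ k, 0 < ℓ k) (k : ℕ) {t : ℝ} (ht : t ∈ Set.Icc (0 : ℝ) 1) :
    cascade ℓ (∑ i ∈ Finset.range k, ℓ i + ℓ k * t) =
      ∑ i ∈ Finset.range k, ℓ i + ℓ k * zigzag^[k + 1] t := by
  have hmono : Monotone fun k => ∑ i ∈ Finset.range k, ℓ i :=
    monotone_nat_of_le_succ fun k => by
      simp only [Finset.sum_range_succ]; linarith [hℓ k]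
  have h0 := mul_nonneg (hℓ k).le ht.1
  have h1 := mul_le_of_le_one_right (hℓ k).le ht.2
  rw [cascade, tsum_eq_sum (s := Finset.range (k + 1)), Finset.sum_range_succ,
    clampedCoord_affine hℓ k ht]
  · congr 1
    refine Finset.sum_congr rfl fun i hi => ?_
    rw [clampedCoord_eq_one hℓ, zigzag_iterate_one, mul_one]
    have := hmono (Nat.succ_le_of_lt (Finset.mem_range.1 hi))
    simp only [Nat.succ_eq_add_one] at this
    linarith
  · intro i hi
    rw [clampedCoord_eq_zero hℓ, zigzag_iterate_zero, mul_zero]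
    have := hmono (show k + 1 ≤ i by simpa using hi)
    simp only [Finset.sum_range_succ] at this
    linarith

theorem cascade_one (hℓ : ∀ k, 0 < ℓ k) (hs : HasSum ℓ 1) : cascade ℓ 1 = 1 := by
  rw [cascade, ← hs.tsum_eq]
  refine tsum_congr fun k => ?_
  rw [hs.tsum_eq, clampedCoord_eq_one hℓ, zigzag_iterate_one, mul_one]
  exact sum_le_hasSum _ (fun i _ => (hℓ i).le) hs

theorem cascade_iterate_affine (hℓ : ∀ k, 0 < ℓ k) (k m : ℕ) {t : ℝ}
    (ht : t ∈ Set.Icc (0 : ℝ) 1) :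
    (cascade ℓ)^[m] (∑ i ∈ Finset.range k, ℓ i + ℓ k * t) =
      ∑ i ∈ Finset.range k, ℓ i + ℓ k * (zigzag^[k + 1])^[m] t := by
  induction m generalizing t with
  | zero => rfl
  | succ m ih =>
    rw [Function.iterate_succ_apply, cascade_affine hℓ k ht, ih (zigzag_iterate_mem _ ht),
      Function.iterate_succ_apply (zigzag^[k + 1])]

/-- The `k`-th term is `3 ^ (k + 1)`-Lipschitz and oscillates by at most `ℓ k`. The first bound
serves for `k < N`, the second for the tail. -/
theorem abs_cascade_sub_le (hℓ : ∀ k, 0 < ℓ k) (hs : HasSum ℓ 1) (N : ℕ) (x y : ℝ) :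
    |cascade ℓ x - cascade ℓ y| ≤
      3 ^ (N + 1) * |x - y| + (1 - ∑ i ∈ Finset.range N, ℓ i) := by
  set f : ℕ → ℝ := fun k => ℓ k * zigzag^[k + 1] (clampedCoord ℓ k x) -
    ℓ k * zigzag^[k + 1] (clampedCoord ℓ k y) with hf
  have hfl : ∀ k, |f k| ≤ ℓ k := fun k => by
    have hx := cascade_term_mem hℓ k x
    have hy := cascade_term_mem hℓ k y
    exact abs_le.2 ⟨by linarith [hx.1, hy.2], by linarith [hx.2, hy.1]⟩
  have hf3 : ∀ k, |f k| ≤ 3 ^ (k + 1) * |x - y| := fun k => by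
    rw [hf]
    simp only
    rw [← mul_sub, abs_mul, abs_of_pos (hℓ k)]
    calc _ ≤ ℓ k * (3 ^ (k + 1) * |clampedCoord ℓ k x - clampedCoord ℓ k y|) :=
          mul_le_mul_of_nonneg_left (abs_zigzag_iterate_sub_le _ _ _) (hℓ k).le
      _ = 3 ^ (k + 1) * (ℓ k * |clampedCoord ℓ k x - clampedCoord ℓ k y|) := by ring
      _ ≤ _ := mul_le_mul_of_nonneg_left (abs_clampedCoord_sub_le hℓ k x y) (by positivity)
  have hsf : Summable fun k => |f k| :=
    hs.summable.of_nonneg_of_le (fun _ => abs_nonneg _) hfl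
  have hgeom : ∑ k ∈ Finset.range N, (3 : ℝ) ^ (k + 1) ≤ 3 ^ (N + 1) := by
    clear_value f
    induction N with
    | zero => simp
    | succ N ih =>
      rw [Finset.sum_range_succ, pow_succ 3 (N + 1)]
      linarith [pow_pos (three_pos (α := ℝ)) (N + 1)]
  have hsub : cascade ℓ x - cascade ℓ y = ∑' k, f k :=
    ((summable_cascade hℓ hs x).tsum_sub (summable_cascade hℓ hs y)).symm
  have htail : ∑' k, ℓ (k + N) = 1 - ∑ i ∈ Finset.range N, ℓ i := by
    have := hs.summable.sum_add_tsum_nat_add N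
    rw [hs.tsum_eq] at this
    linarith
  calc |cascade ℓ x - cascade ℓ y| ≤ ∑' k, |f k| := by
        rw [hsub]
        exact norm_tsum_le_tsum_norm (f := f) hsf
    _ = ∑ k ∈ Finset.range N, |f k| + ∑' k, |f (k + N)| := (hsf.sum_add_tsum_nat_add N).symm
    _ ≤ ∑ k ∈ Finset.range N, 3 ^ (k + 1) * |x - y| + ∑' k, ℓ (k + N) := by
        refine add_le_add (Finset.sum_le_sum fun k _ => hf3 k) ?_
        exact ((summable_nat_add_iff N).2 hsf).tsum_le_tsum (fun k => hfl _)
          ((summable_nat_add_iff N).2 hs.summable)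
    _ ≤ _ := by
        rw [htail, ← Finset.sum_mul]
        gcongr

end Cascade

/-! ### Product maps and bounds on the cube -/

section Product

theorem card_le_sepCard_of_separated {X ι : Type*} [MetricSpace X] [Fintype ι] {φ : X → X}
    {m : ℕ} {ε : ℝ} (hε : 0 ≤ ε) (p : ι → X)
    (h : ∀ s s', s ≠ s' → ∃ k < m, ε < dist (φ^[k] (p s)) (φ^[k] (p s'))) :
    (Fintype.card ι : ℕ∞) ≤ sepCard φ m ε := by
  classical
  have hinj : Function.Injective p := fun s s' hss => by
    by_contra hne
    obtain ⟨k, -, hk⟩ := h s s' hne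
    rw [hss, dist_self] at hk
    exact absurd hk (not_lt.2 hε)
  have hsep : IsSeparatedSet φ m ε ((Finset.univ.image p : Finset X) : Set X) := by
    intro x hx y hy hxy
    obtain ⟨s, -, rfl⟩ := Finset.mem_image.1 (Finset.mem_coe.1 hx)
    obtain ⟨s', -, rfl⟩ := Finset.mem_image.1 (Finset.mem_coe.1 hy)
    obtain ⟨k, hk, hlt⟩ := h s s' fun e => hxy (congrArg p e)
    exact hlt.trans_le (dist_iterate_le_bowenDist hk _ _)
  refine le_trans ?_ (card_le_sepCard hsep)
  rw [Finset.card_image_of_injective _ hinj, Finset.card_univ]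

theorem prodMap_iterate_apply {n : ℕ} (φ : I → I) (k : ℕ) (x : Cube n) (i : Fin n) :
    (prodMap n φ)^[k] x i = φ^[k] (x i) := by
  induction k generalizing x with
  | zero => rfl
  | succ k ih => rw [Function.iterate_succ_apply, ih, Function.iterate_succ_apply]; rfl

theorem dist_apply_le_dist {n : ℕ} (x y : Cube n) (i : Fin n) : dist (x i) (y i) ≤ dist x y := by
  rw [cube_dist, Subtype.dist_eq, Real.dist_eq]
  exact Finset.single_le_sum (f := fun i => |(x i : ℝ) - (y i : ℝ)|) (fun _ _ => abs_nonneg _)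
    (Finset.mem_univ i)

/-- Distinct tuples of separated points differ in some coordinate, and the sum metric dominates the
distance there. -/
theorem card_pow_le_sepCard_prodMap {ι : Type*} [Fintype ι] {φ : I → I} {m : ℕ} {ε : ℝ}
    (hε : 0 ≤ ε) (p : ι → I)
    (h : ∀ s s', s ≠ s' → ∃ k < m, ε < dist (φ^[k] (p s)) (φ^[k] (p s'))) (n : ℕ) :
    ((Fintype.card ι ^ n : ℕ) : ℕ∞) ≤ sepCard (prodMap n φ) m ε := by
  classical
  have := card_le_sepCard_of_separated (φ := prodMap n φ) (m := m) hε
    (fun s : Fin n → ι => (WithLp.toLp 1 fun i => p (s i) : Cube n)) fun s s' hss => by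
      obtain ⟨i, hi⟩ := Function.ne_iff.1 hss
      obtain ⟨k, hk, hlt⟩ := h _ _ hi
      refine ⟨k, hk, hlt.trans_le ?_⟩
      have := dist_apply_le_dist ((prodMap n φ)^[k] (WithLp.toLp 1 fun i => p (s i)))
        ((prodMap n φ)^[k] (WithLp.toLp 1 fun i => p (s' i))) i
      rwa [prodMap_iterate_apply, prodMap_iterate_apply] at this
  simpa using this

theorem continuous_prodMap {φ : I → I} (hφ : Continuous φ) (n : ℕ) : Continuous (prodMap n φ) := by
  refine (PiLp.continuous_toLp 1 _).comp (continuous_pi fun i => hφ.comp ?_)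
  exact (continuous_apply i).comp (PiLp.continuous_ofLp 1 _)

theorem holderWith_of_dist_le {X Y : Type*} [PseudoMetricSpace X] [PseudoMetricSpace Y]
    {K α : ℝ≥0} {f : X → Y} (h : ∀ x y, dist (f x) (f y) ≤ K * dist x y ^ (α : ℝ)) :
    HolderWith K α f := by
  intro x y
  rw [edist_dist, edist_dist, ENNReal.ofReal_rpow_of_nonneg dist_nonneg α.coe_nonneg,
    ← ENNReal.ofReal_coe_nnreal, ← ENNReal.ofReal_mul K.coe_nonneg]
  exact ENNReal.ofReal_le_ofReal (h x y)

theorem holderWith_prodMap {φ : I → I} {K α : ℝ≥0} (hφ : HolderWith K α φ) (n : ℕ) :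
    HolderWith (n * K) α (prodMap n φ) := by
  refine holderWith_of_dist_le fun x y => ?_
  rw [cube_dist]
  calc ∑ i, |((prodMap n φ x) i : ℝ) - ((prodMap n φ y) i : ℝ)|
      ≤ ∑ _i : Fin n, K * dist x y ^ (α : ℝ) := by
        refine Finset.sum_le_sum fun i _ => ?_
        have h1 := hφ.dist_le (x i) (y i)
        have h2 := Real.rpow_le_rpow dist_nonneg (dist_apply_le_dist x y i) α.2
        calc _ = dist (φ (x i)) (φ (y i)) := by rw [Subtype.dist_eq, Real.dist_eq]; rfl
          _ ≤ _ := h1.trans (mul_le_mul_of_nonneg_left h2 K.2)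
    _ = _ := by simp [mul_assoc]

theorem upperMdim_prodMap_le {φ : I → I} {K α : ℝ≥0} (hα : α ≤ 1) (hφ : HolderWith K α φ) {n : ℕ}
    (hn : 1 ≤ n) : upperMdim (prodMap n φ) ≤ ((n * (1 - α) : ℝ) : EReal) :=
  upperMdim_le_of_holder hn (fun x i => (x i : ℝ)) (fun x i => (x i).2)
    (fun x y i => (by rw [Subtype.dist_eq, Real.dist_eq] : _ = dist (x i) (y i)).trans_le
      (dist_apply_le_dist x y i))
    (fun x y => (cube_dist n x y).le) hα (holderWith_prodMap hφ n)

theorem upperMdim_unitInterval_le {φ : I → I} {K α : ℝ≥0} (hα : α ≤ 1) (hφ : HolderWith K α φ) :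
    upperMdim φ ≤ ((1 - α : ℝ) : EReal) := by
  have := upperMdim_le_of_holder le_rfl (fun (x : I) (_ : Fin 1) => (x : ℝ)) (fun x _ => x.2)
    (fun x y _ => by rw [Subtype.dist_eq, Real.dist_eq])
    (fun x y => by rw [Subtype.dist_eq, Real.dist_eq]; simp) hα hφ
  simpa using this

theorem lowerMdim_le_upperMdim {X : Type*} [MetricSpace X] (φ : X → X) :
    lowerMdim φ ≤ upperMdim φ := liminf_le_limsup

theorem lowerMdim_nonneg {X : Type*} [MetricSpace X] [Nonempty X] (φ : X → X) :
    ((0 : ℝ) : EReal) ≤ lowerMdim φ := by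
  refine le_lowerMdim (δ := fun k => 1 / ((k : ℝ) + 1)) (L := fun _ => 0) (fun k => by positivity)
    tendsto_one_div_add_atTop_nhds_zero_nat (fun _ => le_rfl) (fun k ε hε _ => ?_) (by simp)
  have := le_sepRate (φ := φ) (ε := ε) one_pos fun m => by
    have := card_le_sepCard_of_separated (φ := φ) (m := m) hε.le
      (fun _ : Unit => Classical.arbitrary X) fun s s' h => (h (Subsingleton.elim _ _)).elim
    simpa using this
  simpa using this

end Product

/-! ### Lower bound from the decay of the lengths -/

section CascadeMap

variable {ℓ : ℕ → ℝ}

/-- `cascade` as a self-map of the unit interval. -/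
def cascadeMap (ℓ : ℕ → ℝ) (hℓ : ∀ k, 0 < ℓ k) (hs : HasSum ℓ 1) (x : I) : I :=
  ⟨cascade ℓ x, cascade_mem hℓ hs x⟩

variable (hℓ : ∀ k, 0 < ℓ k) (hs : HasSum ℓ 1)

theorem continuous_cascadeMap : Continuous (cascadeMap ℓ hℓ hs) :=
  ((continuous_cascade hℓ hs).comp continuous_subtype_val).subtype_mk _

theorem coe_cascadeMap_iterate (m : ℕ) (x : I) :
    (((cascadeMap ℓ hℓ hs)^[m] x : I) : ℝ) = (cascade ℓ)^[m] x := by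
  induction m generalizing x with
  | zero => rfl
  | succ m ih => rw [Function.iterate_succ_apply, ih, Function.iterate_succ_apply]; rfl

theorem exists_separated_cascadeMap (k m : ℕ) {ε : ℝ} (hε : ε < ℓ k / 3 ^ (k + 1)) :
    ∃ p : (Fin m → Fin (3 ^ k)) → I, ∀ s s', s ≠ s' → ∃ j < m,
      ε < dist ((cascadeMap ℓ hℓ hs)^[j] (p s)) ((cascadeMap ℓ hℓ hs)^[j] (p s')) := by
  obtain ⟨p, hp, hsep⟩ := exists_zigzag_itineraries k m
  have hmem : ∀ t ∈ Set.Icc (0 : ℝ) 1,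
      ∑ i ∈ Finset.range k, ℓ i + ℓ k * t ∈ Set.Icc (0 : ℝ) 1 := by
    intro t ht
    have h1 := sum_le_hasSum (Finset.range (k + 1)) (fun i _ => (hℓ i).le) hs
    rw [Finset.sum_range_succ] at h1
    exact ⟨add_nonneg (Finset.sum_nonneg fun i _ => (hℓ i).le) (mul_nonneg (hℓ k).le ht.1),
      (add_le_add_right (mul_le_of_le_one_right (hℓ k).le ht.2) _).trans h1⟩
  refine ⟨fun s => ⟨_, hmem _ (hp s)⟩, fun s s' hss => ?_⟩
  obtain ⟨j, hj, hd⟩ := hsep s s' hss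
  refine ⟨j, hj, hε.trans_le ?_⟩
  rw [Subtype.dist_eq, coe_cascadeMap_iterate, coe_cascadeMap_iterate,
    cascade_iterate_affine hℓ k j (hp s), cascade_iterate_affine hℓ k j (hp s'), Real.dist_eq,
    add_sub_add_left_eq_sub, ← mul_sub, abs_mul, abs_of_pos (hℓ k), div_eq_mul_inv]
  exact mul_le_mul_of_nonneg_left hd (hℓ k).le

/-- Only the exponential decay rate `r * log 3` of the lengths enters; `r = 0` is allowed and gives
`n`. -/
theorem le_lowerMdim_of_length {X : Type*} [MetricSpace X] {φ : X → X} {r : ℝ} (hr : 0 ≤ r)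
    (n : ℕ) (hℓ : ∀ k, 0 < ℓ k) (hs : HasSum ℓ 1)
    (hlim : Tendsto (fun k : ℕ => -Real.log (ℓ (k + 1)) / k) atTop (𝓝 (r * Real.log 3)))
    (h : ∀ k m ε, 0 < ε → ε < ℓ k / 3 ^ (k + 1) → ((((3 ^ k) ^ n) ^ m : ℕ) : ℕ∞) ≤ sepCard φ m ε) :
    ((n * (1 / (r + 1)) : ℝ) : EReal) ≤ lowerMdim φ := by
  have hlog3 : 0 < Real.log 3 := Real.log_pos (by norm_num)
  refine le_lowerMdim (δ := fun k => ℓ k / 3 ^ (k + 1)) (L := fun k => n * (k * Real.log 3))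
    (fun k => div_pos (hℓ k) (by positivity)) ?_ (fun k => by positivity) ?_ ?_
  · refine squeeze_zero (fun k => (div_pos (hℓ k) (by positivity)).le) (fun k => ?_)
      hs.summable.tendsto_atTop_zero
    exact div_le_self (hℓ k).le (one_le_pow₀ (by norm_num))
  · intro k ε hε hεk
    have := le_sepRate (φ := φ) (B := (3 ^ k) ^ n) (by positivity) fun m => h k m ε hε hεk
    simpa using this
  -- The scale of index `k + 1` carries the factor `3 ^ (k + 2)`; this is its logarithm divided by
  -- `k`.
  · have h2 : Tendsto (fun k : ℕ => (1 + 2 / (k : ℝ)) * Real.log 3) atTop (𝓝 (Real.log 3)) := by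
      simpa using ((tendsto_const_div_atTop_nhds_zero_nat (2 : ℝ)).const_add 1).mul_const
        (Real.log 3)
    have h3 := (tendsto_const_nhds (x := n * Real.log 3)).div (hlim.add h2) (by positivity)
    have h4 : n * Real.log 3 / (r * Real.log 3 + Real.log 3) = n * (1 / (r + 1)) := by
      field_simp
    rw [h4] at h3
    refine h3.congr' ?_
    filter_upwards [eventually_gt_atTop 0] with k hk
    have hk' : (0 : ℝ) < k := by exact_mod_cast hk
    rw [Real.log_div (hℓ _).ne' (by positivity), Real.log_pow]
    have : -(Real.log (ℓ (k + 1)) - ((k + 1 + 1 : ℕ) : ℝ) * Real.log 3) =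
        k * (-Real.log (ℓ (k + 1)) / k + (1 + 2 / k) * Real.log 3) := by
      push_cast
      field_simp
      ring
    rw [this, show (n : ℝ) * (k * Real.log 3) = k * (n * Real.log 3) by ring,
      mul_div_mul_left _ _ hk'.ne']
    rfl

theorem le_lowerMdim_prodMap_cascadeMap {r : ℝ} (hr : 0 ≤ r) (n : ℕ)
    (hlim : Tendsto (fun k : ℕ => -Real.log (ℓ (k + 1)) / k) atTop (𝓝 (r * Real.log 3))) :
    ((n * (1 / (r + 1)) : ℝ) : EReal) ≤ lowerMdim (prodMap n (cascadeMap ℓ hℓ hs)) := by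
  refine le_lowerMdim_of_length hr n hℓ hs hlim fun k m ε hε hεk => ?_
  obtain ⟨p, hp⟩ := exists_separated_cascadeMap hℓ hs k m hεk
  have := card_pow_le_sepCard_prodMap hε.le p hp n
  simp only [Fintype.card_pi, Fintype.card_fin, Finset.prod_const, Finset.card_univ] at this
  rwa [pow_right_comm] at this

theorem le_lowerMdim_cascadeMap {r : ℝ} (hr : 0 ≤ r)
    (hlim : Tendsto (fun k : ℕ => -Real.log (ℓ (k + 1)) / k) atTop (𝓝 (r * Real.log 3))) :
    ((1 / (r + 1) : ℝ) : EReal) ≤ lowerMdim (cascadeMap ℓ hℓ hs) := by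
  have := le_lowerMdim_of_length hr 1 hℓ hs hlim (φ := cascadeMap ℓ hℓ hs) fun k m ε hε hεk => by
    obtain ⟨p, hp⟩ := exists_separated_cascadeMap hℓ hs k m hεk
    simpa using card_le_sepCard_of_separated hε.le p hp
  simpa using this

end CascadeMap

/-! ### Geometric and subexponential lengths -/

section Lengths

/-- The length of the interval `[a_k, a_{k+1}]` between consecutive nodes. -/
def horseshoeLength (r : ℝ) (k : ℕ) : ℝ :=
  (((3 : ℝ) ^ r - 1) / (3 : ℝ) ^ r) / (3 : ℝ) ^ ((k : ℝ) * r)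

theorem horseshoeLength_pos {r : ℝ} (hr : 0 < r) (k : ℕ) : 0 < horseshoeLength r k := by
  have h1 : (1 : ℝ) < 3 ^ r := Real.one_lt_rpow (by norm_num) hr
  have h2 : (0 : ℝ) < 3 ^ r - 1 := by linarith
  unfold horseshoeLength
  positivity

theorem node_eq (r : ℝ) (k : ℕ) : node r k = 1 - 1 / (3 : ℝ) ^ ((k : ℝ) * r) := by
  induction k with
  | zero => simp [node]
  | succ k ih =>
    have h : (3 : ℝ) ^ (((k + 1 : ℕ) : ℝ) * r) = 3 ^ ((k : ℝ) * r) * 3 ^ r := by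
      rw [← Real.rpow_add (by norm_num)]; push_cast; ring_nf
    have h1 : (0 : ℝ) < 3 ^ ((k : ℝ) * r) := by positivity
    have h2 : (0 : ℝ) < 3 ^ r := by positivity
    rw [node, Finset.sum_range_succ, ← node, ih, h]
    field_simp
    ring

theorem hasSum_horseshoeLength {r : ℝ} (hr : 0 < r) : HasSum (horseshoeLength r) 1 := by
  rw [hasSum_iff_tendsto_nat_of_nonneg fun k => (horseshoeLength_pos hr k).le]
  have h : (fun k => ∑ i ∈ Finset.range k, horseshoeLength r i) =
      fun k : ℕ => 1 - ((3 : ℝ) ^ (-r)) ^ k := by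
    funext k
    refine (node_eq r k).trans ?_
    rw [one_div, ← Real.rpow_neg (by norm_num), ← Real.rpow_natCast, ← Real.rpow_mul (by norm_num)]
    ring_nf
  rw [h]
  have := tendsto_pow_atTop_nhds_zero_of_lt_one (r := (3 : ℝ) ^ (-r)) (by positivity)
    (Real.rpow_lt_one_of_one_lt_of_neg (by norm_num) (by linarith))
  simpa using this.const_sub 1

theorem tendsto_log_horseshoeLength {r : ℝ} (hr : 0 < r) :
    Tendsto (fun k : ℕ => -Real.log (horseshoeLength r (k + 1)) / k) atTop
      (𝓝 (r * Real.log 3)) := by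
  have h1 : (1 : ℝ) < 3 ^ r := Real.one_lt_rpow (by norm_num) hr
  have h2 : (0 : ℝ) < 3 ^ r - 1 := by linarith
  set C : ℝ := ((3 : ℝ) ^ r - 1) / 3 ^ r with hC
  have hCpos : 0 < C := by positivity
  have hlim : Tendsto (fun k : ℕ => (r * Real.log 3 - Real.log C) / k + r * Real.log 3) atTop
      (𝓝 (r * Real.log 3)) := by
    simpa using (tendsto_const_div_atTop_nhds_zero_nat (r * Real.log 3 - Real.log C)).add_const
      (r * Real.log 3)
  refine hlim.congr' ?_
  filter_upwards [eventually_gt_atTop 0] with k hk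
  have hk' : (0 : ℝ) < k := by exact_mod_cast hk
  rw [horseshoeLength, ← hC, Real.log_div hCpos.ne' (by positivity), Real.log_rpow (by norm_num)]
  push_cast
  field_simp
  ring

/-- Points at distance `t` about `3 ^ (-(r + 1) * N)` balance the two terms of `abs_cascade_sub_le`:
both `3 ^ N * t` and the remaining length `3 ^ (-(N + 1) * r)` are at most `t ^ (1 - a)`. -/
theorem holderWith_cascadeMap_horseshoeLength {r : ℝ} (hr : 0 < r) :
    HolderWith 10 (Real.toNNReal (1 - 1 / (r + 1)))
      (cascadeMap (horseshoeLength r) (horseshoeLength_pos hr) (hasSum_horseshoeLength hr)) := by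
  refine holderWith_of_dist_le fun x y => ?_
  set a : ℝ := 1 / (r + 1) with ha
  have hα : 1 - a = r / (r + 1) := by rw [ha]; field_simp; ring
  have hα0 : 0 < 1 - a := by rw [hα]; positivity
  rw [Real.coe_toNNReal _ hα0.le, Subtype.dist_eq, Subtype.dist_eq, Real.dist_eq, Real.dist_eq]
  set t : ℝ := |(x : ℝ) - y| with ht
  have ht1 : t ≤ 1 := abs_le.2 ⟨by linarith [x.2.1, y.2.2], by linarith [x.2.2, y.2.1]⟩
  rcases (abs_nonneg ((x : ℝ) - y)).eq_or_lt with h0 | h0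
  · have hxy : (x : ℝ) = y := by linarith [abs_eq_zero.1 h0.symm]
    have hxy' : x = y := Subtype.ext hxy
    rw [hxy', sub_self, abs_zero]
    positivity
  rw [← ht] at h0
  have hq0 : (0 : ℝ) < 3 ^ (-(r + 1)) := by positivity
  obtain ⟨N, hN1, hN2⟩ := exists_nat_pow_near_of_lt_one h0 ht1 hq0
    (Real.rpow_lt_one_of_one_lt_of_neg (by norm_num) (by linarith))
  rw [← Real.rpow_natCast, ← Real.rpow_mul (by norm_num)] at hN1 hN2
  have hta : 0 < t ^ (1 - a) := by positivity
  have h1 : 3 ^ N * t ≤ t ^ (1 - a) := by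
    have h := Real.rpow_le_rpow h0.le hN2 (show 0 ≤ a by positivity)
    rw [← Real.rpow_mul (by norm_num),
      show -(r + 1) * (N : ℝ) * a = -N by rw [ha]; field_simp, Real.rpow_neg (by norm_num),
      Real.rpow_natCast, le_inv_comm₀ (by positivity) (by positivity)] at h
    calc 3 ^ N * t ≤ (t ^ a)⁻¹ * t := by gcongr
      _ = t ^ (1 - a) := by rw [Real.rpow_sub h0, Real.rpow_one]; ring
  have h2 : 1 / (3 : ℝ) ^ (((N + 1 : ℕ) : ℝ) * r) ≤ t ^ (1 - a) := by
    have h := Real.rpow_le_rpow (by positivity) hN1.le hα0.le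
    rw [← Real.rpow_mul (by norm_num), show -(r + 1) * ((N + 1 : ℕ) : ℝ) * (1 - a) =
      -(((N + 1 : ℕ) : ℝ) * r) by rw [hα]; field_simp, Real.rpow_neg (by norm_num)] at h
    rwa [one_div]
  -- Cutting at `N + 1` gives slope `3 ^ (N + 2) = 9 * 3 ^ N`; with the tail this makes the constant
  -- `10 = 9 + 1`.
  have h3 := abs_cascade_sub_le (horseshoeLength_pos hr) (hasSum_horseshoeLength hr) (N + 1) x y
  have h4 : ∑ i ∈ Finset.range (N + 1), horseshoeLength r i =
    1 - 1 / (3 : ℝ) ^ (((N + 1 : ℕ) : ℝ) * r) := node_eq r (N + 1)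
  rw [h4, sub_sub_cancel, ← ht, pow_succ, pow_succ] at h3
  refine h3.trans ?_
  push_cast at h2 ⊢
  linarith

theorem isHorseshoeMap_cascadeMap {r : ℝ} (hr : 0 < r) :
    IsHorseshoeMap (1 / (r + 1))
      (cascadeMap (horseshoeLength r) (horseshoeLength_pos hr) (hasSum_horseshoeLength hr)) := by
  refine ⟨fun h => absurd h (by positivity), fun r' hr' h => ?_⟩
  obtain rfl : r = r' := by
    rw [one_div, one_div, inv_inj] at h
    linarith
  refine ⟨Subtype.ext (cascade_one (horseshoeLength_pos hr) (hasSum_horseshoeLength hr)),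
    fun k x hx => ?_⟩
  have hlen : node r (k + 1) - node r k = horseshoeLength r k := by
    rw [node, Finset.sum_range_succ, ← node, add_sub_cancel_left]; rfl
  have hpos := horseshoeLength_pos hr k
  have hmem : chart r k x ∈ Set.Icc (0 : ℝ) 1 := by
    rw [chart, hlen]
    refine ⟨div_nonneg (by linarith [hx.1]) hpos.le, ?_⟩
    rw [div_le_one hpos]
    linarith [hx.2]
  have hx' : (x : ℝ) = node r k + horseshoeLength r k * chart r k x := by
    rw [chart, hlen]; field_simp; ring
  have := cascade_affine (horseshoeLength_pos hr) k hmem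
  rw [chartInv, hlen]
  change cascade (horseshoeLength r) x = _
  conv_lhs => rw [hx']
  exact this

/-- Lengths with sum `1` that decay subexponentially. -/
def telescopingLength (k : ℕ) : ℝ := 1 / (((k : ℝ) + 1) * (k + 2))

theorem telescopingLength_pos (k : ℕ) : 0 < telescopingLength k := by
  unfold telescopingLength; positivity

theorem hasSum_telescopingLength : HasSum telescopingLength 1 := by
  rw [hasSum_iff_tendsto_nat_of_nonneg fun k => (telescopingLength_pos k).le]
  have h : (fun k => ∑ i ∈ Finset.range k, telescopingLength i) =
      fun k : ℕ => 1 - 1 / ((k : ℝ) + 1) := by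
    funext k
    induction k with
    | zero => simp
    | succ k ih =>
      rw [Finset.sum_range_succ, ih, telescopingLength]
      push_cast
      field_simp
      ring
  rw [h]
  simpa using (tendsto_one_div_add_atTop_nhds_zero_nat (𝕜 := ℝ)).const_sub 1

theorem tendsto_log_telescopingLength :
    Tendsto (fun k : ℕ => -Real.log (telescopingLength (k + 1)) / k) atTop
      (𝓝 (0 * Real.log 3)) := by
  have h : ∀ c : ℝ, Tendsto (fun k : ℕ => Real.log ((k : ℝ) + c) / k) atTop (𝓝 0) := fun c => by
    have := (Real.tendsto_pow_log_div_mul_add_atTop 1 (-c) 1 one_ne_zero).comp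
      (tendsto_atTop_add_const_right _ c (tendsto_natCast_atTop_atTop (R := ℝ)))
    simpa [Function.comp_def] using this
  rw [zero_mul, ← add_zero 0]
  refine ((h 2).add (h 3)).congr fun k => ?_
  rw [telescopingLength, one_div, Real.log_inv, neg_neg, ← add_div,
    ← Real.log_mul (by positivity) (by positivity)]
  push_cast
  ring_nf

theorem holderWith_zero_unitInterval (φ : I → I) : HolderWith 1 0 φ := by
  refine holderWith_of_dist_le fun x y => ?_
  simp only [NNReal.coe_zero, Real.rpow_zero, NNReal.coe_one, mul_one]
  rw [Subtype.dist_eq, Real.dist_eq]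
  exact abs_le.2 ⟨by linarith [(φ x).2.1, (φ y).2.2], by linarith [(φ x).2.2, (φ y).2.1]⟩

end Lengths

/-! ### Choice of the map and conclusion -/

theorem exists_holder_map_lowerMdim_ge {a : ℝ} (ha : a ∈ Set.Icc (0 : ℝ) 1) :
    ∃ φ : I → I, IsHolderMap (Real.toNNReal (1 - a)) φ ∧ (a : EReal) ≤ lowerMdim φ ∧
      (∀ n : ℕ, ((n * a : ℝ) : EReal) ≤ lowerMdim (prodMap n φ)) ∧
      (a < 1 → IsHorseshoeMap a φ) := by
  rcases ha.1.eq_or_lt with rfl | h0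
  · refine ⟨id, ⟨continuous_id, 1, ?_⟩, lowerMdim_nonneg _, fun n => ?_, fun _ => ?_⟩
    · exact holderWith_of_dist_le fun x y => by simp
    · have : Nonempty (Cube n) := ⟨WithLp.toLp 1 fun _ => 0⟩
      rw [mul_zero]
      exact lowerMdim_nonneg _
    · exact ⟨fun _ => rfl, fun r hr h => absurd h (by positivity)⟩
  -- At `a = 1` the exponent `r` would be `0`, where the geometric lengths vanish; the telescoping
  -- lengths replace them, and Hölder exponent `0` asks only for boundedness.
  rcases ha.2.eq_or_lt with rfl | h1
  · refine ⟨cascadeMap telescopingLength telescopingLength_pos hasSum_telescopingLength,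
      ⟨continuous_cascadeMap _ _, 1, ?_⟩, ?_, fun n => ?_, fun h => absurd h (lt_irrefl _)⟩
    · rw [sub_self, Real.toNNReal_zero]
      exact holderWith_zero_unitInterval _
    · simpa using le_lowerMdim_cascadeMap telescopingLength_pos hasSum_telescopingLength le_rfl
        tendsto_log_telescopingLength
    · simpa using le_lowerMdim_prodMap_cascadeMap telescopingLength_pos hasSum_telescopingLength
        le_rfl n tendsto_log_telescopingLength
  · obtain ⟨r, hr, rfl⟩ : ∃ r : ℝ, 0 < r ∧ a = 1 / (r + 1) :=
      ⟨1 / a - 1, by rw [sub_pos, lt_div_iff₀ h0]; linarith, by simp⟩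
    exact ⟨cascadeMap (horseshoeLength r) (horseshoeLength_pos hr) (hasSum_horseshoeLength hr),
      ⟨continuous_cascadeMap _ _, 10, holderWith_cascadeMap_horseshoeLength hr⟩,
      le_lowerMdim_cascadeMap _ _ hr.le (tendsto_log_horseshoeLength hr),
      fun n => le_lowerMdim_prodMap_cascadeMap _ _ hr.le n (tendsto_log_horseshoeLength hr),
      fun _ => isHorseshoeMap_cascadeMap hr⟩

end MetricMeanDim

end

theorem mainTheorem2 (n : ℕ) (hn : 1 ≤ n) (b : ℝ) (hb : b ∈ Set.Icc (0 : ℝ) (n : ℝ)) :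
    ∃ (φ : unitInterval → unitInterval) (ψ : MetricMeanDim.Cube n → MetricMeanDim.Cube n),
      MetricMeanDim.IsHolderMap (Real.toNNReal (1 - b / n)) ψ ∧
      MetricMeanDim.lowerMdim ψ = (b : EReal) ∧ MetricMeanDim.upperMdim ψ = (b : EReal) ∧
      ψ = MetricMeanDim.prodMap n φ ∧
      MetricMeanDim.IsHolderMap (Real.toNNReal (1 - b / n)) φ ∧
      MetricMeanDim.lowerMdim φ = ((b / n : ℝ) : EReal) ∧ MetricMeanDim.upperMdim φ = ((b / n : ℝ) : EReal) ∧
      (b < n → MetricMeanDim.IsHorseshoeMap (b / n) φ) := by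
  have hn' : (0 : ℝ) < n := by exact_mod_cast hn
  have ha : b / n ∈ Set.Icc (0 : ℝ) 1 := ⟨div_nonneg hb.1 hn'.le, (div_le_one hn').2 hb.2⟩
  obtain ⟨φ, hφ, hlow, hlow', hhs⟩ := MetricMeanDim.exists_holder_map_lowerMdim_ge ha
  obtain ⟨hcont, K, hK⟩ := hφ
  have hα : Real.toNNReal (1 - b / n) ≤ 1 := by
    rw [Real.toNNReal_le_one]; linarith [ha.1]
  have hup := MetricMeanDim.upperMdim_unitInterval_le hα hK
  have hup' := MetricMeanDim.upperMdim_prodMap_le hα hK hn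
  -- With `α = 1 - b / n` the Hölder bound `1 - α` is exactly `b / n`, meeting the lower bound.
  rw [Real.coe_toNNReal _ (by linarith [ha.2]), sub_sub_cancel] at hup hup'
  replace hlow' := hlow' n
  rw [mul_div_cancel₀ _ hn'.ne'] at hup' hlow'
  have hle := MetricMeanDim.lowerMdim_le_upperMdim φ
  have hle' := MetricMeanDim.lowerMdim_le_upperMdim (MetricMeanDim.prodMap n φ)
  exact ⟨φ, MetricMeanDim.prodMap n φ,
    ⟨MetricMeanDim.continuous_prodMap hcont n, _, MetricMeanDim.holderWith_prodMap hK n⟩,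
    (hle'.trans hup').antisymm hlow', hup'.antisymm (hlow'.trans hle'), rfl, ⟨hcont, K, hK⟩,
    (hle.trans hup).antisymm hlow, hup.antisymm (hlow.trans hle),
    fun h => hhs ((div_lt_one hn').2 h)⟩
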